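/- Let $n\ge 0$ be an integer, let $\mathbf C^+=\{\omega\in\mathbf C:\operatorname{Im}\omega>0\}$, and let $\mathcal H^n$ be the space of symmetric complex $n\times n$ matrices $M$ whose entrywise imaginary part $\operatorname{Im}M$ is positive definite. Let $K$ be a compact topological space and let $F\colon K\times\mathbf C^+\to\mathcal H^n$ be a continuous map such that $\omega\mapsto F(u,\omega)$ is holomorphic on $\mathbf C^+$ for each $u\in K$. Put $U_1=\{\omega=x+iy\in\mathbf C: -1<x<1,\ y\ge 1\}$ and $F'=\partial F/\partial\omega$. Then there are constants $C_1>0$ and $C_2$, which may depend on $F$ but not on $(u,\omega)$, such that for all $u\in K$ and all $\omega=x+iy\in U_1$ $$\det\operatorname{Im}F(u,\omega)\ \ge\ C_1\,y^{-n}\qquad\text{and}\qquad |\det F'(u,\omega)|\ \le\ C_2 .$$ -/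

import Mathlib

/-- The space of symmetric complex `n × n` matrices whose (entrywise) imaginary part is a
positive definite real matrix. -/
def siegelUpperHalfSpace (n : ℕ) : Set (Matrix (Fin n) (Fin n) ℂ) :=
  {M | M.IsSymm ∧ (M.map Complex.im).PosDef}

/-- The half-strip `{x + i y : -1 < x < 1, 1 ≤ y}`. -/
def halfStrip : Set ℂ := {ω | -1 < ω.re ∧ ω.re < 1 ∧ 1 ≤ ω.im}

/-- A matrix-valued function of one complex variable is holomorphic on `U`
if each of its entries is. -/
def MatrixHolomorphicOn {n : ℕ} (G : ℂ → Matrix (Fin n) (Fin n) ℂ) (U : Set ℂ) : Prop :=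
  ∀ i j, DifferentiableOn ℂ (fun ω => G ω i j) U

/-- The entrywise complex derivative of a matrix-valued function. -/
noncomputable def matrixDeriv {n : ℕ} (G : ℂ → Matrix (Fin n) (Fin n) ℂ) (ω : ℂ) :
    Matrix (Fin n) (Fin n) ℂ :=
  Matrix.of fun i j => deriv (fun w => G w i j) ω

/-!
For a complex vector `v ≠ 0` the function `ω ↦ v* G(ω) v` is a holomorphic self-map of the upper
half-plane as soon as the Hermitian imaginary part `ℑ G = (G - G*) / 2i` is positive definite; for
a symmetric matrix `ℑ G` is the entrywise imaginary part. By Schwarz–Pick it does not increase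
hyperbolic distances, so `v* ℑ G(z) v ≤ e ^ dist(z, w) · v* ℑ G(w) v` and
`Im z · |v* G'(z) v| ≤ v* ℑ G(z) v`. Such inequalities pass to determinants: if
`|v* A v| ≤ c |v* B v|` for all `v`, then the eigenvalues of `B⁻¹ A` have modulus at most `c`. In
the half-strip `e ^ dist(i, ω) ≤ 3 Im ω`, hence everything is controlled by `det ℑ G(i)`, which is
bounded above and away from zero when the parameter runs over a compact space.
-/

open scoped ComplexOrder ComplexStarModule
open UpperHalfPlane hiding I
open Complex Matrix Metric Set

/-- The Cayley transform of the upper half-plane onto the unit disc that sends `a` to `0`; it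
transports the Schwarz lemma to the upper half-plane. -/
noncomputable def cayley (a : ℍ) (z : ℂ) : ℂ := (z - a) / (z - star (a : ℂ))

/-- The inverse of the Cayley transform `cayley a`, from the unit disc onto the upper
half-plane. -/
noncomputable def cayleyInv (a : ℍ) (ζ : ℂ) : ℂ := (a - star (a : ℂ) * ζ) / (1 - ζ)

theorem sub_star_ne_zero (z w : ℍ) : (z : ℂ) - star (w : ℂ) ≠ 0 := by
  intro h
  have him : z.im + w.im = 0 := by simpa using congrArg Complex.im h
  exact (add_pos z.im_pos w.im_pos).ne' him

@[simp] theorem cayley_self (a : ℍ) : cayley a a = 0 := by simp [cayley]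

@[simp] theorem cayleyInv_zero (a : ℍ) : cayleyInv a 0 = a := by simp [cayleyInv]

theorem cayleyInv_cayley (a z : ℍ) : cayleyInv a (cayley a z) = z := by
  have hz := sub_star_ne_zero z a
  have ha := sub_star_ne_zero a a
  have hden : 1 - cayley a z = (a - star (a : ℂ)) / (z - star (a : ℂ)) := by
    rw [cayley]
    field_simp
    ring
  rw [cayleyInv, hden, cayley]
  field_simp
  ring

theorem norm_cayley (a z : ℍ) : ‖cayley a z‖ = Real.tanh (dist z a / 2) := by
  rw [tanh_half_dist, cayley, norm_div, Complex.dist_eq, Complex.dist_eq]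
  rfl

theorem norm_cayley_lt_one (a z : ℍ) : ‖cayley a z‖ < 1 :=
  norm_cayley a z ▸ Real.tanh_lt_one _

theorem one_sub_ne_zero_of_mem_ball {ζ : ℂ} (hζ : ζ ∈ ball (0 : ℂ) 1) : 1 - ζ ≠ 0 := by
  intro h
  simp [← sub_eq_zero.1 h] at hζ

theorem im_cayleyInv (a : ℍ) (ζ : ℂ) :
    (cayleyInv a ζ).im = a.im * (1 - normSq ζ) / normSq (1 - ζ) := by
  simp only [cayleyInv, RCLike.star_def, Complex.div_im, sub_im, coe_im, mul_im, conj_re, coe_re,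
    conj_im, neg_mul, sub_re, one_re, normSq_apply, one_im, zero_sub, mul_neg, neg_neg, mul_re,
    sub_neg_eq_add]
  ring

theorem mapsTo_cayleyInv (a : ℍ) : MapsTo (cayleyInv a) (ball 0 1) upperHalfPlaneSet := by
  intro ζ hζ
  have hnum : normSq ζ < 1 := by
    rw [normSq_eq_norm_sq]
    exact pow_lt_one₀ (norm_nonneg ζ) (mem_ball_zero_iff.1 hζ) two_ne_zero
  have hden : 0 < normSq (1 - ζ) := normSq_pos.2 (one_sub_ne_zero_of_mem_ball hζ)
  change 0 < (cayleyInv a ζ).im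
  rw [im_cayleyInv]
  exact div_pos (mul_pos a.im_pos (sub_pos.2 hnum)) hden

theorem differentiableOn_cayleyInv (a : ℍ) : DifferentiableOn ℂ (cayleyInv a) (ball 0 1) :=
  DifferentiableOn.div (by fun_prop) (by fun_prop) fun _ => one_sub_ne_zero_of_mem_ball

theorem differentiableOn_cayley (a : ℍ) : DifferentiableOn ℂ (cayley a) upperHalfPlaneSet :=
  DifferentiableOn.div (by fun_prop) (by fun_prop) fun z hz => sub_star_ne_zero ⟨z, hz⟩ a

theorem hasDerivAt_cayleyInv_zero (a : ℍ) :
    HasDerivAt (cayleyInv a) (a - star (a : ℂ)) 0 := by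
  have hnum : HasDerivAt (fun ζ : ℂ => a - star (a : ℂ) * ζ) (-star (a : ℂ)) 0 := by
    simpa using ((hasDerivAt_id (0 : ℂ)).const_mul (star (a : ℂ))).const_sub (a : ℂ)
  have hden : HasDerivAt (fun ζ : ℂ => 1 - ζ) (-1) 0 := (hasDerivAt_id 0).const_sub 1
  refine (hnum.fun_div hden (by simp)).congr_deriv ?_
  simp only [RCLike.star_def, sub_zero, mul_one, mul_zero, mul_neg, sub_neg_eq_add, one_pow,
    div_one]
  ring

theorem hasDerivAt_cayley_self (a : ℍ) :
    HasDerivAt (cayley a) (a - star (a : ℂ))⁻¹ a := by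
  have ha := sub_star_ne_zero a a
  refine (((hasDerivAt_id (a : ℂ)).sub_const (a : ℂ)).fun_div
    ((hasDerivAt_id (a : ℂ)).sub_const (star (a : ℂ))) ha).congr_deriv ?_
  simp only [id_eq, sub_self, one_mul, zero_mul, sub_zero]
  field_simp

theorem norm_sub_star_self (a : ℍ) : ‖(a : ℂ) - star (a : ℂ)‖ = 2 * a.im := by
  rw [Complex.star_def, sub_conj]
  simp [abs_of_pos a.im_pos]

section SchwarzPick

variable {f : ℂ → ℂ} (hf : DifferentiableOn ℂ f upperHalfPlaneSet)
  (hmaps : MapsTo f upperHalfPlaneSet upperHalfPlaneSet)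

include hf hmaps in
theorem differentiableOn_cayley_comp_cayleyInv (a b : ℍ) :
    DifferentiableOn ℂ (cayley b ∘ f ∘ cayleyInv a) (ball 0 1) :=
  (differentiableOn_cayley b).comp (hf.comp (differentiableOn_cayleyInv a) (mapsTo_cayleyInv a))
    (hmaps.comp (mapsTo_cayleyInv a))

include hmaps in
theorem mapsTo_cayley_comp_cayleyInv (a b : ℍ) :
    MapsTo (cayley b ∘ f ∘ cayleyInv a) (ball 0 1) (closedBall 0 1) := fun ζ hζ =>
  mem_closedBall_zero_iff.2
    (norm_cayley_lt_one b ⟨f (cayleyInv a ζ), hmaps (mapsTo_cayleyInv a hζ)⟩).le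

theorem cayley_comp_cayleyInv_zero (f : ℂ → ℂ) {a b : ℍ} (hab : f a = b) :
    (cayley b ∘ f ∘ cayleyInv a) 0 = 0 := by
  simp only [Function.comp_apply, cayleyInv_zero, hab, cayley_self]

include hf in
theorem dist_le_dist_of_mapsTo_upperHalfPlaneSet (z w : ℍ) :
    dist (⟨f z, hmaps z.im_pos⟩ : ℍ) ⟨f w, hmaps w.im_pos⟩ ≤ dist z w := by
  set fz : ℍ := ⟨f z, hmaps z.im_pos⟩
  set fw : ℍ := ⟨f w, hmaps w.im_pos⟩
  have hnorm : ‖cayley fw fz‖ ≤ ‖cayley w z‖ := by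
    simpa [cayleyInv_cayley] using
      norm_le_norm_of_mapsTo_ball (differentiableOn_cayley_comp_cayleyInv hf hmaps w fw)
        (mapsTo_cayley_comp_cayleyInv hmaps w fw) (cayley_comp_cayleyInv_zero f rfl)
        (norm_cayley_lt_one w z)
  rw [norm_cayley, norm_cayley] at hnorm
  have hhalf := Real.artanh_le_artanh (Real.neg_one_lt_tanh _) (Real.tanh_lt_one _) hnorm
  rw [Real.artanh_tanh, Real.artanh_tanh] at hhalf
  linarith

include hf hmaps in
theorem im_le_im_mul_exp_dist_of_mapsTo_upperHalfPlaneSet (z w : ℍ) :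
    (f z).im ≤ (f w).im * Real.exp (dist z w) :=
  (im_le_im_mul_exp_dist ⟨f z, hmaps z.im_pos⟩ ⟨f w, hmaps w.im_pos⟩).trans <|
    mul_le_mul_of_nonneg_left
      (Real.exp_le_exp.2 (dist_le_dist_of_mapsTo_upperHalfPlaneSet hf hmaps z w))
      (hmaps w.im_pos).le

include hf hmaps in
theorem norm_deriv_mul_im_le_of_mapsTo_upperHalfPlaneSet (z : ℍ) :
    ‖deriv f z‖ * z.im ≤ (f z).im := by
  set fz : ℍ := ⟨f z, hmaps z.im_pos⟩
  have hderiv : HasDerivAt (cayley fz ∘ f ∘ cayleyInv z)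
      ((fz - star (fz : ℂ))⁻¹ * (deriv f z * (z - star (z : ℂ)))) 0 := by
    have hfz : HasDerivAt f (deriv f z) z :=
      (hf.differentiableAt (isOpen_upperHalfPlaneSet.mem_nhds z.im_pos)).hasDerivAt
    refine HasDerivAt.comp (0 : ℂ) ?_ (HasDerivAt.comp (0 : ℂ) ?_ (hasDerivAt_cayleyInv_zero z))
    · simpa only [Function.comp_apply, cayleyInv_zero] using hasDerivAt_cayley_self fz
    · simpa only [cayleyInv_zero] using hfz
  have hzero := cayley_comp_cayleyInv_zero f (a := z) (b := fz) rfl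
  have hle := norm_deriv_le_one_of_mapsTo_ball (c := 0)
    (differentiableOn_cayley_comp_cayleyInv hf hmaps z fz)
    (hzero.symm ▸ mapsTo_cayley_comp_cayleyInv hmaps z fz) one_pos
  rw [hderiv.deriv, norm_mul, norm_inv, norm_mul, norm_sub_star_self, norm_sub_star_self,
    inv_mul_le_one₀ (mul_pos two_pos fz.im_pos)] at hle
  change _ ≤ fz.im
  linarith

end SchwarzPick

theorem im_pos_of_mem_halfStrip {ω : ℂ} (hω : ω ∈ halfStrip) : 0 < ω.im :=
  zero_lt_one.trans_le hω.2.2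

theorem exp_dist_I_le_of_mem_halfStrip {ω : ℍ} (hω : (ω : ℂ) ∈ halfStrip) :
    Real.exp (dist UpperHalfPlane.I ω) ≤ 3 * ω.im := by
  obtain ⟨hre_gt, hre_lt, him⟩ := hω
  have him' : 1 ≤ ω.im := him
  have hcosh : 2 * Real.cosh (dist UpperHalfPlane.I ω) = (ω.re ^ 2 + ω.im ^ 2 + 1) / ω.im := by
    have := ω.im_pos
    rw [cosh_dist, Complex.dist_eq, Complex.sq_norm, normSq_apply]
    simp only [UpperHalfPlane.coe_I, sub_re, Complex.I_re, coe_re, zero_sub, mul_neg, neg_mul,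
      neg_neg, sub_im, Complex.I_im, coe_im, UpperHalfPlane.I_im, mul_one]
    field_simp
    ring
  have hsq : ω.re ^ 2 ≤ 1 := by
    rw [sq_le_one_iff_abs_le_one]
    exact abs_le.2 ⟨hre_gt.le, hre_lt.le⟩
  calc Real.exp (dist UpperHalfPlane.I ω) ≤ 2 * Real.cosh (dist UpperHalfPlane.I ω) := by
        rw [Real.cosh_eq]
        linarith [Real.exp_pos (-dist UpperHalfPlane.I ω)]
    _ = (ω.re ^ 2 + ω.im ^ 2 + 1) / ω.im := hcosh
    _ ≤ 3 * ω.im := by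
        rw [div_le_iff₀ ω.im_pos]
        nlinarith

section NumericalRange

variable {ι : Type*} [Fintype ι]

theorem norm_det_le_pow_of_forall_eigenvector [DecidableEq ι] {A : Matrix ι ι ℂ} {c : ℝ}
    (h : ∀ (μ : ℂ) (v : ι → ℂ), v ≠ 0 → A *ᵥ v = μ • v → ‖μ‖ ≤ c) :
    ‖A.det‖ ≤ c ^ Fintype.card ι := by
  have hroot : ∀ μ ∈ A.charpoly.roots, ‖μ‖ ≤ c := by
    intro μ hμ
    obtain ⟨v, hv, hAv⟩ := exists_mulVec_eq_zero_iff.2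
      ((eval_charpoly A μ).symm.trans (Polynomial.isRoot_of_mem_roots hμ))
    refine h μ v hv ?_
    rwa [sub_mulVec, scalar_apply, ← smul_one_eq_diagonal, smul_mulVec, one_mulVec, sub_eq_zero,
      eq_comm] at hAv
  calc ‖A.det‖ = (A.charpoly.roots.map norm).prod := by
        rw [det_eq_prod_roots_charpoly]
        exact map_multiset_prod (normHom : ℂ →*₀ ℝ) _
    _ ≤ (A.charpoly.roots.map fun _ => c).prod :=
        Multiset.prod_map_le_prod_map₀ _ _ (fun _ _ => norm_nonneg _) hroot
    _ = c ^ Fintype.card ι := by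
        simp [← (IsAlgClosed.splits A.charpoly).natDegree_eq_card_roots]

theorem norm_det_le_of_forall_norm_star_dotProduct_mulVec_le [DecidableEq ι] {A B : Matrix ι ι ℂ}
    {c : ℝ} (hB : ∀ v ≠ 0, star v ⬝ᵥ B *ᵥ v ≠ 0)
    (hAB : ∀ v ≠ 0, ‖star v ⬝ᵥ A *ᵥ v‖ ≤ c * ‖star v ⬝ᵥ B *ᵥ v‖) :
    ‖A.det‖ ≤ c ^ Fintype.card ι * ‖B.det‖ := by
  have hdet : IsUnit B.det := by
    rw [isUnit_iff_ne_zero, ne_eq, ← exists_mulVec_eq_zero_iff]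
    rintro ⟨v, hv, hBv⟩
    exact hB v hv (by rw [hBv, dotProduct_zero])
  have hfactor : A = B * (B⁻¹ * A) := (mul_nonsing_inv_cancel_left B A hdet).symm
  have hquot : ‖(B⁻¹ * A).det‖ ≤ c ^ Fintype.card ι := by
    refine norm_det_le_pow_of_forall_eigenvector fun μ v hv hμ => ?_
    have hAv : A *ᵥ v = μ • B *ᵥ v := by
      rw [hfactor, ← mulVec_mulVec, hμ, mulVec_smul]
    refine le_of_mul_le_mul_right ?_ (norm_pos_iff.2 (hB v hv))
    simpa [hAv, dotProduct_smul] using hAB v hv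
  calc ‖A.det‖ = ‖(B⁻¹ * A).det‖ * ‖B.det‖ := by
        rw [← norm_mul, mul_comm, ← det_mul, ← hfactor]
    _ ≤ c ^ Fintype.card ι * ‖B.det‖ := by gcongr

theorem star_dotProduct_imaginaryPart_mulVec (M : Matrix ι ι ℂ) (v : ι → ℂ) :
    star v ⬝ᵥ (ℑ M : Matrix ι ι ℂ) *ᵥ v = ((star v ⬝ᵥ M *ᵥ v).im : ℂ) := by
  have hstar : star v ⬝ᵥ star M *ᵥ v = star (star v ⬝ᵥ M *ᵥ v) := by
    rw [star_eq_conjTranspose, mulVec_conjTranspose, star_dotProduct_star, ← dotProduct_mulVec]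
  rw [imaginaryPart_apply_coe, smul_mulVec, smul_mulVec, sub_mulVec,
    dotProduct_smul, dotProduct_smul, dotProduct_sub, hstar, Complex.star_def, sub_conj]
  apply Complex.ext <;> simp

theorem im_star_dotProduct_mulVec_pos {M : Matrix ι ι ℂ} (hM : (ℑ M : Matrix ι ι ℂ).PosDef)
    {v : ι → ℂ} (hv : v ≠ 0) : 0 < (star v ⬝ᵥ M *ᵥ v).im := by
  simpa [star_dotProduct_imaginaryPart_mulVec] using hM.re_dotProduct_pos hv

theorem mapsTo_star_dotProduct_mulVec {X : Type*} {G : X → Matrix ι ι ℂ} {s : Set X}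
    (hG : ∀ x ∈ s, (ℑ (G x) : Matrix ι ι ℂ).PosDef) {v : ι → ℂ} (hv : v ≠ 0) :
    MapsTo (fun x => star v ⬝ᵥ G x *ᵥ v) s upperHalfPlaneSet := fun x hx =>
  im_star_dotProduct_mulVec_pos (hG x hx) hv

theorem norm_star_dotProduct_imaginaryPart_mulVec {M : Matrix ι ι ℂ}
    (hM : (ℑ M : Matrix ι ι ℂ).PosDef) (v : ι → ℂ) :
    ‖star v ⬝ᵥ (ℑ M : Matrix ι ι ℂ) *ᵥ v‖ = (star v ⬝ᵥ M *ᵥ v).im := by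
  rcases eq_or_ne v 0 with rfl | hv
  · simp
  · rw [star_dotProduct_imaginaryPart_mulVec, norm_real,
      Real.norm_of_nonneg (im_star_dotProduct_mulVec_pos hM hv).le]

theorem norm_det_le_of_forall_norm_le_im [DecidableEq ι] {A M : Matrix ι ι ℂ} {c : ℝ}
    (hM : (ℑ M : Matrix ι ι ℂ).PosDef)
    (h : ∀ v ≠ 0, ‖star v ⬝ᵥ A *ᵥ v‖ ≤ c * (star v ⬝ᵥ M *ᵥ v).im) :
    ‖A.det‖ ≤ c ^ Fintype.card ι * ‖(ℑ M : Matrix ι ι ℂ).det‖ :=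
  norm_det_le_of_forall_norm_star_dotProduct_mulVec_le
    (fun _ hv => (hM.dotProduct_mulVec_pos hv).ne')
    fun v hv => (norm_star_dotProduct_imaginaryPart_mulVec hM v).symm ▸ h v hv

end NumericalRange

theorem continuous_coe_imaginaryPart {ι : Type*} :
    Continuous fun M : Matrix ι ι ℂ => (ℑ M : Matrix ι ι ℂ) := by
  simp only [imaginaryPart_apply_coe]
  fun_prop

open scoped MatrixOrder in
theorem posDef_map_ofReal {ι : Type*} [Finite ι] {A : Matrix ι ι ℝ} (hA : A.PosDef) :
    (A.map ofReal).PosDef := by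
  classical
  have := Fintype.ofFinite ι
  obtain ⟨B, hB⟩ := CStarAlgebra.nonneg_iff_eq_star_mul_self.1 hA.posSemidef.nonneg
  have hfactor : A.map ofReal = (B.map ofReal)ᴴ * B.map ofReal := by
    rw [hB, star_eq_conjTranspose, ← conjTranspose_map _ fun x => (conj_ofReal x).symm]
    exact map_mul (ofRealHom.mapMatrix) _ _
  have hdet : (A.map ofReal).det ≠ 0 := by
    rw [show (A.map ofReal).det = (A.det : ℂ) from (ofRealHom.map_det A).symm]
    exact ofReal_ne_zero.2 hA.det_pos.ne'
  refine PosSemidef.posDef_iff_det_ne_zero ?_ |>.2 hdet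
  rw [hfactor]
  exact posSemidef_conjTranspose_mul_self _

theorem imaginaryPart_eq_map_im_of_isSymm {ι : Type*} {M : Matrix ι ι ℂ} (hM : M.IsSymm) :
    (ℑ M : Matrix ι ι ℂ) = (M.map im).map ofReal := by
  ext i j
  rw [imaginaryPart_apply_coe]
  simp only [Matrix.smul_apply, Matrix.sub_apply, star_apply, hM.apply i j, RCLike.star_def,
    sub_conj, ofReal_mul, ofReal_ofNat, real_smul, ofReal_inv, smul_eq_mul, neg_mul, map_apply]
  apply Complex.ext <;> simp

section Siegel

variable {n : ℕ} {M : Matrix (Fin n) (Fin n) ℂ}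

theorem posDef_imaginaryPart_of_mem_siegelUpperHalfSpace (hM : M ∈ siegelUpperHalfSpace n) :
    (ℑ M : Matrix (Fin n) (Fin n) ℂ).PosDef := by
  rw [imaginaryPart_eq_map_im_of_isSymm hM.1]
  exact posDef_map_ofReal hM.2

theorem norm_det_imaginaryPart_of_mem_siegelUpperHalfSpace (hM : M ∈ siegelUpperHalfSpace n) :
    ‖(ℑ M : Matrix (Fin n) (Fin n) ℂ).det‖ = (M.map im).det := by
  rw [imaginaryPart_eq_map_im_of_isSymm hM.1,
    show ((M.map im).map ofReal).det = ((M.map im).det : ℂ) from (ofRealHom.map_det _).symm,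
    norm_real, Real.norm_of_nonneg hM.2.det_pos.le]

end Siegel

namespace MatrixHolomorphicOn

variable {n : ℕ} {G : ℂ → Matrix (Fin n) (Fin n) ℂ}

theorem hasDerivAt_star_dotProduct_mulVec {U : Set ℂ} (hG : MatrixHolomorphicOn G U)
    (hU : IsOpen U) {ω : ℂ} (hω : ω ∈ U) (v : Fin n → ℂ) :
    HasDerivAt (fun w => star v ⬝ᵥ G w *ᵥ v) (star v ⬝ᵥ matrixDeriv G ω *ᵥ v) ω :=
  HasDerivAt.fun_sum fun i _ => (HasDerivAt.fun_sum fun j _ =>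
    ((hG i j).differentiableAt (hU.mem_nhds hω)).hasDerivAt.mul_const (v j)).const_mul (star v i)

variable (hG : MatrixHolomorphicOn G upperHalfPlaneSet)
  (hpos : ∀ ω ∈ upperHalfPlaneSet, (ℑ (G ω) : Matrix (Fin n) (Fin n) ℂ).PosDef)

include hG in
theorem differentiableOn_star_dotProduct_mulVec (v : Fin n → ℂ) :
    DifferentiableOn ℂ (fun ω => star v ⬝ᵥ G ω *ᵥ v) upperHalfPlaneSet := fun _ hω =>
  (hG.hasDerivAt_star_dotProduct_mulVec isOpen_upperHalfPlaneSet hω v).differentiableAt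
    |>.differentiableWithinAt

include hG hpos

theorem norm_det_imaginaryPart_le (z w : ℍ) :
    ‖(ℑ (G z) : Matrix (Fin n) (Fin n) ℂ).det‖ ≤
      Real.exp (dist z w) ^ n * ‖(ℑ (G w) : Matrix (Fin n) (Fin n) ℂ).det‖ := by
  suffices h : ∀ v ≠ 0, ‖star v ⬝ᵥ (ℑ (G z) : Matrix (Fin n) (Fin n) ℂ) *ᵥ v‖ ≤
      Real.exp (dist z w) * (star v ⬝ᵥ G w *ᵥ v).im by
    simpa only [Fintype.card_fin] using norm_det_le_of_forall_norm_le_im (hpos w w.im_pos) h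
  intro v hv
  rw [norm_star_dotProduct_imaginaryPart_mulVec (hpos z z.im_pos), mul_comm]
  exact im_le_im_mul_exp_dist_of_mapsTo_upperHalfPlaneSet
    (hG.differentiableOn_star_dotProduct_mulVec v) (mapsTo_star_dotProduct_mulVec hpos hv) z w

theorem norm_det_matrixDeriv_le (z : ℍ) :
    ‖(matrixDeriv G z).det‖ ≤ z.im⁻¹ ^ n * ‖(ℑ (G z) : Matrix (Fin n) (Fin n) ℂ).det‖ := by
  suffices h : ∀ v ≠ 0, ‖star v ⬝ᵥ matrixDeriv G z *ᵥ v‖ ≤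
      z.im⁻¹ * (star v ⬝ᵥ G z *ᵥ v).im by
    simpa only [Fintype.card_fin] using norm_det_le_of_forall_norm_le_im (hpos z z.im_pos) h
  intro v hv
  have hderiv := hG.hasDerivAt_star_dotProduct_mulVec isOpen_upperHalfPlaneSet z.im_pos v
  rw [← hderiv.deriv, le_inv_mul_iff₀ z.im_pos, mul_comm]
  exact norm_deriv_mul_im_le_of_mapsTo_upperHalfPlaneSet
    (hG.differentiableOn_star_dotProduct_mulVec v) (mapsTo_star_dotProduct_mulVec hpos hv) z

theorem norm_det_imaginaryPart_I_le_of_mem_halfStrip {ω : ℂ} (hω : ω ∈ halfStrip) :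
    ‖(ℑ (G I) : Matrix (Fin n) (Fin n) ℂ).det‖ ≤
      (3 * ω.im) ^ n * ‖(ℑ (G ω) : Matrix (Fin n) (Fin n) ℂ).det‖ := by
  lift ω to ℍ using im_pos_of_mem_halfStrip hω
  refine (norm_det_imaginaryPart_le hG hpos UpperHalfPlane.I ω).trans ?_
  gcongr
  exact exp_dist_I_le_of_mem_halfStrip hω

theorem norm_det_matrixDeriv_le_of_mem_halfStrip {ω : ℂ} (hω : ω ∈ halfStrip) :
    ‖(matrixDeriv G ω).det‖ ≤ 3 ^ n * ‖(ℑ (G I) : Matrix (Fin n) (Fin n) ℂ).det‖ := by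
  lift ω to ℍ using im_pos_of_mem_halfStrip hω
  have hexp : ω.im⁻¹ * Real.exp (dist ω UpperHalfPlane.I) ≤ 3 := by
    rw [inv_mul_le_iff₀ ω.im_pos, mul_comm ω.im, dist_comm]
    exact exp_dist_I_le_of_mem_halfStrip hω
  calc ‖(matrixDeriv G ω).det‖
      ≤ ω.im⁻¹ ^ n * ‖(ℑ (G ω) : Matrix (Fin n) (Fin n) ℂ).det‖ :=
        norm_det_matrixDeriv_le hG hpos ω
    _ ≤ ω.im⁻¹ ^ n * (Real.exp (dist ω UpperHalfPlane.I) ^ n *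
          ‖(ℑ (G I) : Matrix (Fin n) (Fin n) ℂ).det‖) := by
        have := ω.im_pos
        gcongr
        exact norm_det_imaginaryPart_le hG hpos ω UpperHalfPlane.I
    _ = (ω.im⁻¹ * Real.exp (dist ω UpperHalfPlane.I)) ^ n *
          ‖(ℑ (G I) : Matrix (Fin n) (Fin n) ℂ).det‖ := by
        rw [mul_pow, mul_assoc]
    _ ≤ 3 ^ n * ‖(ℑ (G I) : Matrix (Fin n) (Fin n) ℂ).det‖ := by
        have := ω.im_pos
        gcongr

end MatrixHolomorphicOn

theorem mainTheorem7_general (n : ℕ) {K : Type*} [TopologicalSpace K] [CompactSpace K]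
    (F : K → ℂ → Matrix (Fin n) (Fin n) ℂ)
    (hF_pos : ∀ u : K, ∀ ω ∈ upperHalfPlaneSet, (ℑ (F u ω) : Matrix (Fin n) (Fin n) ℂ).PosDef)
    (hF_cont : Continuous fun u => F u I)
    (hF_hol : ∀ u : K, MatrixHolomorphicOn (F u) upperHalfPlaneSet) :
    ∃ C₁ C₂ : ℝ, 0 < C₁ ∧ ∀ u : K, ∀ ω ∈ halfStrip,
      C₁ * ω.im ^ (-(n : ℤ)) ≤ ‖(ℑ (F u ω) : Matrix (Fin n) (Fin n) ℂ).det‖ ∧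
      ‖(matrixDeriv (F u) ω).det‖ ≤ C₂ := by
  have hcont : Continuous fun u => ‖(ℑ (F u I) : Matrix (Fin n) (Fin n) ℂ).det‖ :=
    (continuous_coe_imaginaryPart.comp hF_cont).matrix_det.norm
  obtain ⟨m, hm, hm_le⟩ := isCompact_univ.exists_forall_le' (a := 0) hcont.continuousOn
    fun u _ => norm_pos_iff.2 (hF_pos u I UpperHalfPlane.I.im_pos).det_pos.ne'
  obtain ⟨B, hB⟩ := isCompact_univ.bddAbove_image hcont.continuousOn
  refine ⟨m / 3 ^ n, 3 ^ n * B, by positivity, fun u ω hω => ⟨?_, ?_⟩⟩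
  · have hy := im_pos_of_mem_halfStrip hω
    rw [_root_.zpow_neg, zpow_natCast, ← div_eq_mul_inv, div_div, ← mul_pow,
      div_le_iff₀' (by positivity)]
    exact (hm_le u (mem_univ u)).trans
      ((hF_hol u).norm_det_imaginaryPart_I_le_of_mem_halfStrip (hF_pos u) hω)
  · refine ((hF_hol u).norm_det_matrixDeriv_le_of_mem_halfStrip (hF_pos u) hω).trans ?_
    gcongr
    exact hB (mem_image_of_mem _ (mem_univ u))

theorem mainTheorem7 (n : ℕ) {K : Type*} [TopologicalSpace K] [CompactSpace K]
    (F : K → ℂ → Matrix (Fin n) (Fin n) ℂ)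
    (hF_mem : ∀ u : K, ∀ ω ∈ UpperHalfPlane.upperHalfPlaneSet, F u ω ∈ siegelUpperHalfSpace n)
    (hF_cont : ContinuousOn (fun p : K × ℂ => F p.1 p.2) (Set.univ ×ˢ UpperHalfPlane.upperHalfPlaneSet))
    (hF_hol : ∀ u : K, MatrixHolomorphicOn (F u) UpperHalfPlane.upperHalfPlaneSet) :
    ∃ C₁ C₂ : ℝ, 0 < C₁ ∧ ∀ u : K, ∀ ω ∈ halfStrip,
      C₁ * ω.im ^ (-(n : ℤ)) ≤ ((F u ω).map Complex.im).det ∧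
      ‖(matrixDeriv (F u) ω).det‖ ≤ C₂ := by
  obtain ⟨C₁, C₂, hC₁, h⟩ := mainTheorem7_general n F
    (fun u ω hω => posDef_imaginaryPart_of_mem_siegelUpperHalfSpace (hF_mem u ω hω))
    (hF_cont.comp_continuous (.prodMk_left I) fun _ => ⟨mem_univ _, UpperHalfPlane.I.im_pos⟩)
    hF_hol
  exact ⟨C₁, C₂, hC₁, fun u ω hω => norm_det_imaginaryPart_of_mem_siegelUpperHalfSpace
    (hF_mem u ω (im_pos_of_mem_halfStrip hω)) ▸ h u ω hω⟩
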